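/- Let $d\ge 0$ and let $A=(a_{ij})_{i,j=1}^d$ be a symmetrizable generalized Cartan matrix: $a_{ij}\in\mathbb Z$, $a_{ii}=2$, $a_{ij}\le 0$ for $i\ne j$, $a_{ij}=0\iff a_{ji}=0$, and $A=DB$ with $D=\operatorname{diag}(\varepsilon_1,\dots,\varepsilon_d)$, all $\varepsilon_i\in\mathbb R\setminus\{0\}$, and $B$ a real symmetric matrix. Let $(\mathfrak h_{\mathbb R},\{\alpha_i\},\{\alpha_i^\vee\})$ be a realization of $A$ over $\mathbb R$ (that is, $\dim\mathfrak h_{\mathbb R}=2d-\operatorname{rank}A$, the simple roots $\alpha_i\in\mathfrak h_{\mathbb R}^*$ are linearly independent, the simple coroots $\alpha_i^\vee\in\mathfrak h_{\mathbb R}$ are linearly independent, and $\alpha_j(\alpha_i^\vee)=a_{ij}$), and let $\mathfrak g$ be the associated complex Kac–Moody algebra with Cartan subalgebra $\mathfrak h=\mathbb C\otimes_{\mathbb R}\mathfrak h_{\mathbb R}$. Thus $\mathfrak g$ is the quotient of the Lie algebra generated by $\mathfrak h$ and $e_i,f_i$ ($1\le i\le d$) subject to $[x,y]=0$, $[e_i,f_j]=\delta_{ij}\alpha_i^\vee$,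 $[x,e_i]=\alpha_i(x)e_i$, $[x,f_i]=-\alpha_i(x)f_i$ ($x,y\in\mathfrak h$) by its largest ideal meeting $\mathfrak h$ trivially. Let $Q=\sum_i\mathbb Z\alpha_i$ be the root lattice. A root is a nonzero $\beta\in Q$ such that $\mathfrak g_\beta=\{g\in\mathfrak g:[x,g]=\beta(x)g\ \forall x\in\mathfrak h\}$ is nonzero; it is positive if its coordinates with respect to $\alpha_1,\dots,\alpha_d$ are all $\ge 0$; it is real if it lies in the closure of $\{\alpha_1,\dots,\alpha_d\}$ under the fundamental reflections $w_i(\beta)=\beta-\beta(\alpha_i^\vee)\alpha_i$, and imaginary otherwise. On $Q$ put $\left(\sum_i n_i\alpha_i,\sum_j m_j\alpha_j\right)=\sum_{i,j}n_i b_{ij}m_j$. Let $\Delta_f$ be the set of positive imaginary roots $\beta$ such that $(\beta,\alpha_j)\le 0$ for all $j$. Let $$\Gamma=\{x\in\mathfrak h_{\mathbb R}:\alpha_i(x)\ge 0\text{ for all }i\},\qquad \Gamma^*=\{y\in\mathfrak h_{\mathbb R}^*: y(x)\ge 0\text{ for all }x\in\Gamma\}$$ be the fundamental chamber and its dual cone,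 and let $G=Q\cap\Gamma^*$ be the additive semigroup (with $0$) of lattice points of $\Gamma^*$. Then $\Delta_f\subseteq G$, the semigroup $G$ is finitely generated, and $G$ has a Hilbert basis: a finite set $S$ such that every element of $G$ is a linear combination of elements of $S$ with coefficients in $\mathbb N=\{0,1,2,\dots\}$, and such that $S$ is minimal among the sets with this property, both with respect to inclusion and with respect to cardinality. -/

import Mathlib

open scoped TensorProduct

noncomputable section

namespace KacMoody

/-- Generalized Cartan matrices. -/
structure IsGCM {d : ℕ} (A : Matrix (Fin d) (Fin d) ℤ) : Prop where
  diag : ∀ i, A i i = 2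
  off_diag_nonpos : ∀ i j, i ≠ j → A i j ≤ 0
  zero_iff : ∀ i j, A i j = 0 ↔ A j i = 0

/-- A (minimal) realization over `ℝ` of the integer matrix `A`: a real vector space `V` (the real
form `𝔥_ℝ` of the Cartan subalgebra) of dimension `2 d - rank A`, with linearly independent simple
roots `α_j ∈ V*` and linearly independent simple coroots `α_i^∨ ∈ V` such that
`α_j(α_i^∨) = a_{ij}`. -/
structure Realization {d : ℕ} (A : Matrix (Fin d) (Fin d) ℤ)
    (V : Type*) [AddCommGroup V] [Module ℝ V] where
  finite : FiniteDimensional ℝ V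
  root : Fin d → Module.Dual ℝ V
  coroot : Fin d → V
  root_linearIndependent : LinearIndependent ℝ root
  coroot_linearIndependent : LinearIndependent ℝ coroot
  root_coroot : ∀ i j, root j (coroot i) = (A i j : ℝ)
  finrank_add_rank : Module.finrank ℝ V + (A.map (Int.cast : ℤ → ℝ)).rank = 2 * d

/-! ### The Kac-Moody algebra

`H` is the complex Cartan subalgebra, `α` the family of simple roots, `c` the family of simple
coroots. -/

section Algebra

/-- Generators: the elements of `H` and the Chevalley generators `e_i`, `f_i`. -/
inductive Gen (d : ℕ) (H : Type*) where
  | ofCartan : H → Gen d H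
  | e : Fin d → Gen d H
  | f : Fin d → Gen d H

variable {d : ℕ} {H : Type*} [AddCommGroup H] [Module ℂ H]

/-- The free Lie algebra on the generators. -/
abbrev FreeAlg (d : ℕ) (H : Type*) := FreeLieAlgebra ℂ (Gen d H)

/-- The generator attached to `x ∈ H`, in the free Lie algebra. -/
def gh (d : ℕ) {H : Type*} (x : H) : FreeAlg d H := FreeLieAlgebra.of ℂ (Gen.ofCartan x)

/-- The generator `e_i` in the free Lie algebra. -/
def ge (H : Type*) (i : Fin d) : FreeAlg d H := FreeLieAlgebra.of ℂ (Gen.e i)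

/-- The generator `f_i` in the free Lie algebra. -/
def gf (H : Type*) (i : Fin d) : FreeAlg d H := FreeLieAlgebra.of ℂ (Gen.f i)

/-- The defining relations (written as elements that are set to zero) of the auxiliary Lie algebra:
`x ↦ gh x` is linear, `[x, y] = 0`, `[e_i, f_j] = δ_{ij} α_i^∨`, `[x, e_i] = α_i(x) e_i`,
`[x, f_i] = -α_i(x) f_i`. -/
inductive Relation (α : Fin d → Module.Dual ℂ H) (c : Fin d → H) : FreeAlg d H → Prop
  | add (x y : H) : Relation α c (gh d (x + y) - (gh d x + gh d y))
  | smul (t : ℂ) (x : H) : Relation α c (gh d (t • x) - t • gh d x)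
  | cartan (x y : H) : Relation α c ⁅gh d x, gh d y⁆
  | ef (i : Fin d) : Relation α c (⁅ge H i, gf H i⁆ - gh d (c i))
  | ef_ne (i j : Fin d) (hij : i ≠ j) : Relation α c ⁅ge H i, gf H j⁆
  | he (x : H) (i : Fin d) : Relation α c (⁅gh d x, ge H i⁆ - α i x • ge H i)
  | hf (x : H) (i : Fin d) : Relation α c (⁅gh d x, gf H i⁆ + α i x • gf H i)

/-- The ideal of the free Lie algebra generated by the relations. -/
def relIdeal (α : Fin d → Module.Dual ℂ H) (c : Fin d → H) : LieIdeal ℂ (FreeAlg d H) :=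
  LieSubmodule.lieSpan ℂ _ {x | Relation α c x}

/-- The auxiliary Lie algebra defined by these relations. -/
abbrev Aux (α : Fin d → Module.Dual ℂ H) (c : Fin d → H) := FreeAlg d H ⧸ relIdeal α c

/-- The canonical map of `H` into the auxiliary Lie algebra. -/
def cartanAux (α : Fin d → Module.Dual ℂ H) (c : Fin d → H) : H →ₗ[ℂ] Aux α c where
  toFun x := LieSubmodule.Quotient.mk (gh d x)
  map_add' x y := (Submodule.Quotient.eq (relIdeal α c).toSubmodule).2
    (LieSubmodule.subset_lieSpan (Relation.add x y))
  map_smul' t x := (Submodule.Quotient.eq (relIdeal α c).toSubmodule).2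
    (LieSubmodule.subset_lieSpan (Relation.smul t x))

/-- The largest ideal of the auxiliary Lie algebra intersecting `H` trivially, as the sum of all
such ideals. -/
def radIdeal (α : Fin d → Module.Dual ℂ H) (c : Fin d → H) : LieIdeal ℂ (Aux α c) :=
  sSup {I | Disjoint I.toSubmodule (LinearMap.range (cartanAux α c))}

/-- The Kac-Moody algebra `𝔤`, the quotient of the auxiliary Lie algebra by that ideal. -/
abbrev KMAlgebra (α : Fin d → Module.Dual ℂ H) (c : Fin d → H) := Aux α c ⧸ radIdeal α c

/-- The canonical map of `H` into the Kac-Moody algebra. -/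
def cartan (α : Fin d → Module.Dual ℂ H) (c : Fin d → H) : H →ₗ[ℂ] KMAlgebra α c :=
  (radIdeal α c).toSubmodule.mkQ ∘ₗ cartanAux α c

/-- The space `𝔤_β` of all `g ∈ 𝔤` with `[x, g] = β(x) g` for every `x ∈ H`. -/
def rootSpace (α : Fin d → Module.Dual ℂ H) (c : Fin d → H) (β : Module.Dual ℂ H) :
    Submodule ℂ (KMAlgebra α c) where
  carrier := {g | ∀ x : H, ⁅cartan α c x, g⁆ = β x • g}
  add_mem' {g g'} hg hg' x := by rw [lie_add, hg x, hg' x, smul_add]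
  zero_mem' x := by rw [lie_zero, smul_zero]
  smul_mem' t g hg x := by rw [lie_smul, hg x, smul_comm]

end Algebra

/-! ### Roots, the root lattice and the fundamental chamber -/

namespace Realization

variable {d : ℕ} {A : Matrix (Fin d) (Fin d) ℤ} {V : Type*} [AddCommGroup V] [Module ℝ V]
  (R : Realization A V)

/-- The multiplicity `m(β) = dim 𝔤_β` of a functional `β ∈ 𝔥_ℝ*`, extended `ℂ`-linearly
to the Cartan subalgebra `𝔥 = ℂ ⊗ 𝔥_ℝ`; the algebra `𝔤` is the one of the simple roots `α_i`
(extended to `𝔥`) and the simple coroots `1 ⊗ α_i^∨`. -/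
def mult (β : Module.Dual ℝ V) : Cardinal :=
  Module.rank ℂ (rootSpace (H := ℂ ⊗[ℝ] V)
    (fun i => (R.root i).baseChange ℂ) (fun i => (1 : ℂ) ⊗ₜ[ℝ] R.coroot i) (β.baseChange ℂ))

/-- The element `∑ n_i α_i` with coordinate vector `n`. -/
def ofCoords (n : Fin d → ℤ) : Module.Dual ℝ V := ∑ i, n i • R.root i

/-- The root lattice `Q`, generated by the simple roots. -/
def rootLattice : AddSubgroup (Module.Dual ℝ V) := AddSubgroup.closure (Set.range R.root)

/-- Roots: the nonzero elements of the root lattice of positive multiplicity. -/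
def IsRoot (β : Module.Dual ℝ V) : Prop := β ∈ R.rootLattice ∧ β ≠ 0 ∧ 0 < R.mult β

/-- Real roots: the closure of the simple roots under the fundamental reflections
`w_i(β) = β - β(α_i^∨) α_i`. -/
inductive IsRealRoot : Module.Dual ℝ V → Prop
  | simple (i : Fin d) : IsRealRoot (R.root i)
  | reflect (i : Fin d) (β : Module.Dual ℝ V) (hβ : IsRealRoot β) :
      IsRealRoot (β - β (R.coroot i) • R.root i)

/-- Imaginary roots: the roots that are not real. -/
def IsImaginaryRoot (β : Module.Dual ℝ V) : Prop := R.IsRoot β ∧ ¬ R.IsRealRoot β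

/-- The form `(β, γ) = β · B γ` on the root lattice, in coordinates with respect to the simple
roots. -/
def form (B : Matrix (Fin d) (Fin d) ℝ) (n m : Fin d → ℤ) : ℝ :=
  (fun i => (n i : ℝ)) ⬝ᵥ B.mulVec (fun i => (m i : ℝ))

/-- The set `Δ_f` of positive imaginary roots `β` with `(β, α_j) ≤ 0` for every simple root `α_j`.
Positive means that all the coordinates are nonnegative. -/
def fundamentalImaginaryRoots (B : Matrix (Fin d) (Fin d) ℝ) : Set (Module.Dual ℝ V) :=
  {β | R.IsImaginaryRoot β ∧ ∃ n : Fin d → ℤ, β = R.ofCoords n ∧ (∀ i, 0 ≤ n i) ∧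
    ∀ j, form B n (Pi.single j 1) ≤ 0}

/-- The fundamental chamber `Γ = {x ∈ 𝔥_ℝ : α_i(x) ≥ 0 for all i}`. -/
def fundamentalChamber : Set V := {x | ∀ i, 0 ≤ R.root i x}

/-- The dual cone `Γ* = {y ∈ 𝔥_ℝ* : y(x) ≥ 0 for all x ∈ Γ}`. -/
def dualChamber : PointedCone ℝ (Module.Dual ℝ V) :=
  PointedCone.dual (Module.Dual.eval ℝ V) R.fundamentalChamber

/-- The semigroup `Q ∩ Γ*` of lattice points of the dual cone of the fundamental chamber. -/
def chamberSemigroup : AddSubmonoid (Module.Dual ℝ V) :=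
  R.rootLattice.toAddSubmonoid ⊓ R.dualChamber.toAddSubmonoid

end Realization

/-- A Hilbert basis of a commutative semigroup with zero: a finite generating set (every element of
`G` is a combination of elements of `S` with coefficients in `ℕ`) which is minimal, both for
inclusion and for the number of elements. -/
structure IsHilbertBasis {M : Type*} [AddCommMonoid M] (G : AddSubmonoid M) (S : Set M) :
    Prop where
  finite : S.Finite
  closure_eq : AddSubmonoid.closure S = G
  minimal : ∀ T ⊆ S, AddSubmonoid.closure T = G → T = S
  encard_le : ∀ T : Set M, AddSubmonoid.closure T = G → S.encard ≤ T.encard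

end KacMoody

end

namespace KacMoody.Realization

variable {d : ℕ} {A : Matrix (Fin d) (Fin d) ℤ} {V : Type*} [AddCommGroup V] [Module ℝ V]
  (R : Realization A V)

/-! The semigroup `G` is a copy of `ℕ^d`. By linear independence there are vectors `x_i` with
`α_j(x_i) = δ_ij`; they lie in `Γ`, so evaluating an element of `Q ∩ Γ*` at them shows that its
coordinates are nonnegative. The converse is immediate (`mem_chamberSemigroup_iff`), and `Δ_f ⊆ G`
follows because its elements are positive. The simple roots generate `G` (`closure_range_root`), and
each is indecomposable in it, hence lies in every generating set (`range_root_subset`). They are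
thus the least generating set, which gives both kinds of minimality at once. -/

/-- The simple roots admit a dual family of vectors. -/
lemma exists_dual_vectors :
    ∃ x : Fin d → V, ∀ i j, R.root j (x i) = if j = i then 1 else 0 := by
  have := R.finite
  obtain ⟨g, hg⟩ := (Fintype.linearCombination ℝ R.root).exists_leftInverse_of_injective
    (LinearMap.ker_eq_bot.2 R.root_linearIndependent.fintypeLinearCombination_injective)
  -- The coordinates of the left inverse `g` are elements of the bidual; reflexivity of the
  -- finite-dimensional `V` turns them into vectors.
  refine ⟨fun i => (Module.evalEquiv ℝ V).symm (LinearMap.proj i ∘ₗ g), fun i j => ?_⟩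
  have h := LinearMap.congr_fun hg (Pi.single j 1)
  rw [LinearMap.comp_apply, Fintype.linearCombination_apply_single, one_smul] at h
  rw [Module.apply_evalEquiv_symm_apply, LinearMap.comp_apply, h]
  simp [Pi.single_apply, eq_comm]

lemma mem_rootLattice_iff {y : Module.Dual ℝ V} :
    y ∈ R.rootLattice ↔ ∃ n : Fin d → ℤ, y = R.ofCoords n := by
  rw [rootLattice, AddSubgroup.mem_closure_range_iff]
  constructor
  · rintro ⟨n, rfl⟩
    exact ⟨n, by simp [ofCoords, Finsupp.sum_fintype]⟩
  · rintro ⟨n, rfl⟩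
    exact ⟨Finsupp.equivFunOnFinite.symm n, by simp [ofCoords, Finsupp.sum_fintype]⟩

lemma ofCoords_apply (n : Fin d → ℤ) (x : V) : R.ofCoords n x = ∑ i, (n i : ℝ) * R.root i x := by
  simp [ofCoords, LinearMap.sum_apply]

lemma ofCoords_injective : Function.Injective R.ofCoords := by
  obtain ⟨x, hx⟩ := R.exists_dual_vectors
  intro n m h
  ext i
  have := LinearMap.congr_fun h (x i)
  simpa [ofCoords_apply, hx] using this

lemma ofCoords_add (n m : Fin d → ℤ) : R.ofCoords (n + m) = R.ofCoords n + R.ofCoords m := by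
  simp [ofCoords, add_smul, Finset.sum_add_distrib]

lemma ofCoords_single (i : Fin d) : R.ofCoords (Pi.single i 1) = R.root i := by
  simp [ofCoords, Pi.single_apply]

/-- The dual cone of the fundamental chamber meets the root lattice in the elements with
nonnegative coordinates. -/
lemma mem_chamberSemigroup_iff {y : Module.Dual ℝ V} :
    y ∈ R.chamberSemigroup ↔ ∃ n : Fin d → ℤ, y = R.ofCoords n ∧ ∀ i, 0 ≤ n i := by
  have hdual : y ∈ R.dualChamber ↔ ∀ x ∈ R.fundamentalChamber, 0 ≤ y x := by
    simp [dualChamber, PointedCone.mem_dual]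
  have hmem : y ∈ R.chamberSemigroup ↔ y ∈ R.rootLattice ∧ y ∈ R.dualChamber := Iff.rfl
  rw [hmem, hdual, mem_rootLattice_iff]
  constructor
  · rintro ⟨⟨n, rfl⟩, h⟩
    refine ⟨n, rfl, fun i => ?_⟩
    obtain ⟨x, hx⟩ := R.exists_dual_vectors
    -- The dual vector `x i` lies in the chamber, and its value on `y` is the coordinate `n i`.
    have hi := h (x i) fun j => by rw [hx]; split_ifs <;> norm_num
    simpa [ofCoords_apply, hx] using hi
  · rintro ⟨n, rfl, hn⟩
    refine ⟨⟨n, rfl⟩, fun x hx => ?_⟩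
    rw [ofCoords_apply]
    exact Finset.sum_nonneg fun i _ => mul_nonneg (by exact_mod_cast hn i) (hx i)

lemma closure_range_root :
    AddSubmonoid.closure (Set.range R.root) = R.chamberSemigroup := by
  apply le_antisymm
  · rw [AddSubmonoid.closure_le]
    rintro _ ⟨i, rfl⟩
    refine R.mem_chamberSemigroup_iff.2 ⟨Pi.single i 1, (R.ofCoords_single i).symm, fun j => ?_⟩
    rw [Pi.single_apply]
    split_ifs <;> norm_num
  · intro y hy
    obtain ⟨n, rfl, hn⟩ := R.mem_chamberSemigroup_iff.1 hy
    refine AddSubmonoid.sum_mem _ fun i _ => ?_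
    lift n to Fin d → ℕ using hn
    simpa using AddSubmonoid.nsmul_mem _
      (AddSubmonoid.subset_closure (Set.mem_range_self (f := R.root) i)) (n i)

/-- The simple roots are indecomposable, so they lie in every generating set. -/
lemma range_root_subset {T : Set (Module.Dual ℝ V)}
    (hT : AddSubmonoid.closure T = R.chamberSemigroup) : Set.range R.root ⊆ T := by
  rintro _ ⟨i, rfl⟩
  by_contra hi
  -- `M` is `G` with `α_i` removed; closure under addition is exactly the indecomposability of
  -- `α_i`.
  let M : AddSubmonoid (Module.Dual ℝ V) :=
    { carrier := {y | ∃ n : Fin d → ℤ, y = R.ofCoords n ∧ (∀ j, 0 ≤ n j) ∧ n ≠ Pi.single i 1}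
      zero_mem' := ⟨0, by simp [ofCoords], fun _ => le_rfl, fun h => by simpa using congrFun h i⟩
      add_mem' := by
        rintro _ _ ⟨n, rfl, hn, hn'⟩ ⟨m, rfl, hm, hm'⟩
        refine ⟨n + m, (R.ofCoords_add n m).symm, fun j => add_nonneg (hn j) (hm j), fun h => ?_⟩
        have hsum (j : Fin d) : n j + m j = if j = i then 1 else 0 := by
          simpa [Pi.single_apply] using congrFun h j
        have hii := hsum i
        rw [if_pos rfl] at hii
        -- Since `n i + m i = 1` and the other coordinates of both vectors vanish, one summand is
        -- `0` and the other is `α_i`.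
        rcases (hn i).eq_or_lt with h0 | h0
        · refine hm' (funext fun j => ?_)
          have hj := hsum j
          have := hn j
          have := hm j
          rw [Pi.single_apply]
          split_ifs at hj ⊢ with hji
          · subst hji; omega
          · omega
        · refine hn' (funext fun j => ?_)
          have hj := hsum j
          have := hn j
          have := hm j
          have := hm i
          rw [Pi.single_apply]
          split_ifs at hj ⊢ with hji
          · subst hji; omega
          · omega }
  -- A generating set missing `α_i` would generate only elements of `M`.
  have hTM : AddSubmonoid.closure T ≤ M := by
    rw [AddSubmonoid.closure_le]
    intro t ht
    obtain ⟨n, rfl, hn⟩ := R.mem_chamberSemigroup_iff.1 (hT ▸ AddSubmonoid.subset_closure ht)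
    refine ⟨n, rfl, hn, ?_⟩
    rintro rfl
    exact hi (R.ofCoords_single i ▸ ht)
  have hroot : R.root i ∈ AddSubmonoid.closure T := by
    rw [hT, ← closure_range_root]
    exact AddSubmonoid.subset_closure (Set.mem_range_self i)
  obtain ⟨n, hn, -, hne⟩ := hTM hroot
  exact hne (R.ofCoords_injective (by rw [← hn, ofCoords_single]))

/-- The simple roots form a Hilbert basis of the semigroup of lattice points of the dual cone. -/
lemma isHilbertBasis_range_root : IsHilbertBasis R.chamberSemigroup (Set.range R.root) where
  finite := Set.finite_range _
  closure_eq := R.closure_range_root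
  minimal _ hTS hT := hTS.antisymm (R.range_root_subset hT)
  encard_le _ hT := Set.encard_le_encard (R.range_root_subset hT)

end KacMoody.Realization

theorem mainTheorem4 {d : ℕ} (A : Matrix (Fin d) (Fin d) ℤ) (hA : KacMoody.IsGCM A)
    (ε : Fin d → ℝ) (hε : ∀ i, ε i ≠ 0) (B : Matrix (Fin d) (Fin d) ℝ) (hB : B.IsSymm)
    (hAB : A.map (Int.cast : ℤ → ℝ) = Matrix.diagonal ε * B)
    {V : Type*} [AddCommGroup V] [Module ℝ V] (R : KacMoody.Realization A V) :
    R.fundamentalImaginaryRoots B ⊆ (R.chamberSemigroup : Set (Module.Dual ℝ V)) ∧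
      R.chamberSemigroup.FG ∧
      ∃ S : Set (Module.Dual ℝ V), KacMoody.IsHilbertBasis R.chamberSemigroup S := by
  have h := R.isHilbertBasis_range_root
  refine ⟨?_, ?_, _, h⟩
  · rintro β ⟨-, n, rfl, hn, -⟩
    exact R.mem_chamberSemigroup_iff.2 ⟨n, rfl, hn⟩
  · exact (AddSubmonoid.fg_iff _).2 ⟨_, h.closure_eq, h.finite⟩
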